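/- **Setting.** Let $X$, $V$ be finite-dimensional real inner product spaces, $Z$ a real inner product space, $\Omega$ a finite set of pixels (for gray images $V=\mathbb R$), $A:X\to Z$ a bounded linear operator, $u_0\in Z$, $\nabla=(\nabla_1,\nabla_2)$ a pair of linear maps $\nabla_l: X\to V^{\Omega}$ (a discrete gradient), and $\lambda,\mu>0$. Write $|\nabla u|^2(p)=\sum_{l=1}^2\|\nabla_l u(p)\|^2$, $f(u)=\tfrac12\|Au-u_0\|^2$ and $F=f+P$, where $P$ is one of $$P^I(u)=\sum_{p\in\Omega}\tfrac{\mu}{2}\min\big(|\nabla u|^2(p),\tfrac{\lambda}{\mu}\big)\ \text{(ITQ)},\qquad P^A(u)=\sum_{p\in\Omega}\tfrac{\mu}{2}\sum_{l=1}^{2}\min\big(\|\nabla_l u(p)\|^2,\tfrac{\lambda}{\mu}\big)\ \text{(ATQ)}.$$ Write $P=P_1-P_2$ with the convex functions $$P_1^I(u)=\sum_p\tfrac{\mu}{2}\big(|\nabla u|^2(p)+\tfrac{\lambda}{\mu}\big),\quad P_2^I(u)=\sum_p\tfrac{\mu}{2}\max\big(|\nabla u|^2(p),\tfrac{\lambda}{\mu}\big)$$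 for ITQ, and $$P_1^A(u)=\sum_p\tfrac{\mu}{2}\sum_{l}\big(\|\nabla_l u(p)\|^2+\tfrac{\lambda}{\mu}\big),\quad P_2^A(u)=\sum_p\tfrac{\mu}{2}\sum_{l}\max\big(\|\nabla_l u(p)\|^2,\tfrac{\lambda}{\mu}\big)$$ for ATQ. Assume that $F$ is level-bounded (every set $\{F\le\alpha\}$, $\alpha\in\mathbb R$, is bounded). Let $L\ge 0$ be a Lipschitz constant of $\nabla f$ and $M$ a self-adjoint positive definite operator on $X$ with $M\ge L I$; put $\|v\|_M^2=\langle v,Mv\rangle$. **Algorithm (preDCA$_e$).** Let $x^{-1}=x^0\in X$, $\beta_t\in[0,1)$ with $\sup_t\beta_t<1$, and for $t=0,1,2,\dots$ $$\xi^t\in\partial P_2(x^t),\qquad y^t=x^t+\beta_t(x^t-x^{t-1}),\qquad x^{t+1}=\operatorname*{arg\,min}_{z\in X}\Big\{\langle\nabla f(y^t)-\xi^t,z\rangle+\tfrac12\|z-y^t\|_M^2+P_1(z)\Big\},$$ where $\partial P_2$ is the convex subdifferential. The *standard choice* of $\xi^t$ is $\xi^t=\mu\sum_{l}\nabla_l^*\chi_l\nabla_l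 x^t$, where $\chi_l(p)=1$ if $|\nabla x^t|^2(p)\ge\lambda/\mu$ (ITQ), respectively if $\|\nabla_l x^t(p)\|^2\ge\lambda/\mu$ (ATQ), and $\chi_l(p)=0$ otherwise. A point $\bar x$ is a *stationary point* of $F$ if $0\in\partial F(\bar x)$, where $\partial F$ is the limiting subdifferential: $\xi\in\partial F(\bar x)$ iff there are $x_n\to\bar x$ with $F(x_n)\to F(\bar x)$ and $\xi_n\to\xi$ such that $\liminf_{y\to x_n,\,y\ne x_n}\frac{F(y)-F(x_n)-\langle\xi_n,y-x_n\rangle}{\|y-x_n\|}\ge0$ for every $n$. **Theorem.** Let $(x^t)$ be generated by preDCA$_e$ for ITQ or ATQ. 1. For every choice of the subgradients $\xi^t\in\partial P_2(x^t)$, every accumulation point $\bar x$ of $(x^t)$ satisfies $0\in\nabla f(\bar x)+\nabla P_1(\bar x)-\partial P_2(\bar x)$. 2. For the standard choice of $\xi^t$, every accumulation point of $(x^t)$ is a stationary point of $F$, one has $\sum_{t=1}^\infty\|x^t-x^{t-1}\|<\infty$, and the whole sequence $(x^t)$ converges to a stationary point of $F$. -/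

import Mathlib

open Filter Topology
open scoped NNReal RealInnerProductSpace

noncomputable section

/-- The two truncated quadratic models: isotropic (ITQ) and anisotropic (ATQ). -/
inductive TQKind where
  | iso
  | ani

/-- The data of a truncated quadratic problem on the finite dimensional image space `X`:
the operator `A`, the datum `u0`, the two components `grad 0`, `grad 1` of the discrete gradient
(arbitrary linear maps with values in the `V`-valued fields on the finite pixel set `Ω`; gray images
have `V = ℝ`), and the positive parameters `mu`, `lam`. -/
structure TQProblem (X Z V Ω : Type*)
    [NormedAddCommGroup X] [InnerProductSpace ℝ X]
    [NormedAddCommGroup Z] [InnerProductSpace ℝ Z]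
    [NormedAddCommGroup V] [InnerProductSpace ℝ V] where
  kind : TQKind
  A : X →L[ℝ] Z
  u0 : Z
  grad : Fin 2 → X →ₗ[ℝ] (Ω → V)
  mu : ℝ
  lam : ℝ
  mu_pos : 0 < mu
  lam_pos : 0 < lam

/-- The convex subdifferential of a real-valued function. -/
def convexSubdiff {X : Type*} [NormedAddCommGroup X] [InnerProductSpace ℝ X]
    (h : X → ℝ) (x : X) : Set X :=
  {ξ | ∀ y, h x + ⟪ξ, y - x⟫ ≤ h y}

/-- The regular (Fréchet) subdifferential of a real-valued function:
`liminf_{y → x, y ≠ x} (h y - h x - ⟨ξ, y - x⟩) / ‖y - x‖ ≥ 0`. -/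
def regularSubdiff {X : Type*} [NormedAddCommGroup X] [InnerProductSpace ℝ X]
    (h : X → ℝ) (x : X) : Set X :=
  {ξ | (0 : EReal) ≤
    liminf (fun y => (((h y - h x - ⟪ξ, y - x⟫) / ‖y - x‖ : ℝ) : EReal)) (𝓝[≠] x)}

/-- The limiting subdifferential of a real-valued function. -/
def limitingSubdiff {X : Type*} [NormedAddCommGroup X] [InnerProductSpace ℝ X]
    (h : X → ℝ) (x : X) : Set X :=
  {ξ | ∃ (xs ξs : ℕ → X), Tendsto xs atTop (𝓝 x) ∧ Tendsto (fun n => h (xs n)) atTop (𝓝 (h x)) ∧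
    Tendsto ξs atTop (𝓝 ξ) ∧ ∀ n, ξs n ∈ regularSubdiff h (xs n)}

/-- `x` is a stationary point of `h` if `0` is a limiting subgradient of `h` at `x`. -/
def IsLimitingStationary {X : Type*} [NormedAddCommGroup X] [InnerProductSpace ℝ X]
    (h : X → ℝ) (x : X) : Prop :=
  (0 : X) ∈ limitingSubdiff h x

/-- `h` is level-bounded: all its sublevel sets are bounded (possibly empty). -/
def LevelBounded {X : Type*} [NormedAddCommGroup X] (h : X → ℝ) : Prop :=
  ∀ α : ℝ, Bornology.IsBounded {u | h u ≤ α}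

namespace TQProblem

variable {X Z V Ω : Type*}
  [NormedAddCommGroup X] [InnerProductSpace ℝ X]
  [NormedAddCommGroup Z] [InnerProductSpace ℝ Z]
  [NormedAddCommGroup V] [InnerProductSpace ℝ V]

/-- The data term `f u = ‖A u - u0‖² / 2`. -/
def f (Q : TQProblem X Z V Ω) (u : X) : ℝ := ‖Q.A u - Q.u0‖ ^ 2 / 2

/-- `|∇_l u|²` at the pixel `p`. -/
def compSq (Q : TQProblem X Z V Ω) (l : Fin 2) (u : X) (p : Ω) : ℝ := ‖Q.grad l u p‖ ^ 2

/-- `|∇ u|² = |∇_1 u|² + |∇_2 u|²` at the pixel `p`. -/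
def gradSq (Q : TQProblem X Z V Ω) (u : X) (p : Ω) : ℝ := ∑ l, Q.compSq l u p

/-- The truncated quadratic regularizer `P^I` or `P^A`, summed over the pixels. -/
def P [Fintype Ω] (Q : TQProblem X Z V Ω) (u : X) : ℝ :=
  match Q.kind with
  | .iso => ∑ p, Q.mu / 2 * min (Q.gradSq u p) (Q.lam / Q.mu)
  | .ani => ∑ p, Q.mu / 2 * ∑ l, min (Q.compSq l u p) (Q.lam / Q.mu)

/-- The convex part `P_1^I` or `P_1^A`. -/
def P1 [Fintype Ω] (Q : TQProblem X Z V Ω) (u : X) : ℝ :=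
  match Q.kind with
  | .iso => ∑ p, Q.mu / 2 * (Q.gradSq u p + Q.lam / Q.mu)
  | .ani => ∑ p, Q.mu / 2 * ∑ l, (Q.compSq l u p + Q.lam / Q.mu)

/-- The convex part `P_2^I` or `P_2^A`; one has `P = P1 - P2`. -/
def P2 [Fintype Ω] (Q : TQProblem X Z V Ω) (u : X) : ℝ :=
  match Q.kind with
  | .iso => ∑ p, Q.mu / 2 * max (Q.gradSq u p) (Q.lam / Q.mu)
  | .ani => ∑ p, Q.mu / 2 * ∑ l, max (Q.compSq l u p) (Q.lam / Q.mu)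

/-- The objective `F = f + P`. -/
def F [Fintype Ω] (Q : TQProblem X Z V Ω) (u : X) : ℝ := Q.f u + Q.P u

open Classical in
/-- The indicator `χ` of the pixels (and, in the anisotropic case, of the directions `l`) where the
quadratic is truncated, with the value `1` at the threshold. -/
def chi (Q : TQProblem X Z V Ω) (u : X) (l : Fin 2) (p : Ω) : ℝ :=
  match Q.kind with
  | .iso => if Q.lam / Q.mu ≤ Q.gradSq u p then 1 else 0
  | .ani => if Q.lam / Q.mu ≤ Q.compSq l u p then 1 else 0

/-- The selection `μ ∇^* χ ∇ u` (isotropic) or `μ ∑ l, ∇_l^* χ_l ∇_l u` (anisotropic) of the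
subdifferential of `P2` at `u`. -/
def subgradSel [Fintype Ω] [FiniteDimensional ℝ X] [FiniteDimensional ℝ V]
    (Q : TQProblem X Z V Ω) (u : X) : X :=
  Q.mu • ∑ l, ∑ p,
    LinearMap.adjoint ((LinearMap.proj p : (Ω → V) →ₗ[ℝ] V) ∘ₗ Q.grad l)
      (Q.chi u l p • Q.grad l u p)

/-- The sequences `x`, `y`, `ξ` are generated by the preconditioned DCA with extrapolation, with
preconditioning metric `M` and extrapolation parameters `β`. The convention `x^{-1} = x^0` is
`x (0 - 1) = x 0`. -/
structure IsPreDCAe [Fintype Ω] [CompleteSpace X] (Q : TQProblem X Z V Ω) (M : X →ₗ[ℝ] X)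
    (β : ℕ → ℝ) (x y ξ : ℕ → X) : Prop where
  beta_mem : ∀ t, β t ∈ Set.Ico (0 : ℝ) 1
  beta_sup : ⨆ t, β t < 1
  subgrad : ∀ t, ξ t ∈ convexSubdiff Q.P2 (x t)
  extrapolate : ∀ t, y t = x t + β t • (x t - x (t - 1))
  argmin : ∀ t, IsMinOn
    (fun z => ⟪gradient Q.f (y t) - ξ t, z⟫ + 1 / 2 * ⟪z - y t, M (z - y t)⟫ + Q.P1 z)
    Set.univ (x (t + 1))

end TQProblem

end

/-! The objective is piecewise quadratic: on each set where the indicator `chi` equals a fixed `c`,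
`F` coincides with a quadratic function with operator `T + W(1) - W(c)`, where `T` is the Hessian of
`f` and `W` is `weightedOp`; only finitely many `c` occur.

Every choice of subgradients gives descent (`F_succ_le`): `F (x t)` plus half the squared `M`-norm
of the last step decreases by a multiple of that squared step. Hence steps vanish, iterates stay
bounded, and closedness of the subgradient inequality yields the first claim.

For the standard selection, the optimality condition says that the gradient of the active branch at
`x t` is bounded by two consecutive steps. A quadratic satisfies the Łojasiewicz inequality with
exponent 1/2 globally, relative to any critical point. A branch visited infinitely often has a
critical point at the limiting energy, so finiteness gives one constant for all branches, and a
square-root telescoping makes the steps summable.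

An iterate may sit on the truncation threshold, where `F` can have a concave kink and no regular
subgradient. Moving it to `(1 + ε) • x t` leaves the threshold without changing `chi`; there `F` is
locally a convex quadratic, which gives limiting stationarity. -/

section Quadratic

/-! ### Quadratic functions and symmetric operators. -/

variable {X : Type*} [NormedAddCommGroup X] [InnerProductSpace ℝ X]

/-- `q` is the quadratic function `u ↦ ⟪K u, u⟫ / 2 + ⟪b, u⟫ + c` with `K` symmetric. -/
structure IsQuadratic (q : X → ℝ) (K : X →ₗ[ℝ] X) (b : X) (c : ℝ) : Prop where
  symm : K.IsSymmetric
  eq : ∀ u, q u = 1 / 2 * ⟪K u, u⟫ + ⟪b, u⟫ + c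

namespace IsQuadratic

variable {q : X → ℝ} {K : X →ₗ[ℝ] X} {b : X} {c : ℝ}

theorem expansion (h : IsQuadratic q K b c) (u v : X) :
    q v = q u + ⟪K u + b, v - u⟫ + 1 / 2 * ⟪K (v - u), v - u⟫ := by
  have h1 : ⟪K v, u⟫ = ⟪K u, v⟫ := by rw [h.symm v u, real_inner_comm]
  rw [h.eq u, h.eq v]
  simp only [map_sub, inner_sub_left, inner_sub_right, inner_add_left, h1]
  ring

theorem hasGradientAt [FiniteDimensional ℝ X] [CompleteSpace X] (h : IsQuadratic q K b c)
    (u : X) : HasGradientAt q (K u + b) u := by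
  rw [hasGradientAt_iff_isLittleO]
  have h1 : (fun v => q v - q u - ⟪K u + b, v - u⟫)
      = fun v => 1 / 2 * ⟪K (v - u), v - u⟫ := by
    funext v
    rw [h.expansion u v]
    ring
  rw [h1]
  have hc : Tendsto (fun v => ‖K (v - u)‖) (𝓝 u) (𝓝 0) := by
    have : Continuous fun v => ‖K (v - u)‖ :=
      (K.continuous_of_finiteDimensional.comp (continuous_id.sub continuous_const)).norm
    simpa using this.tendsto u
  refine Asymptotics.isLittleO_iff.2 fun ε hε => ?_
  filter_upwards [hc.eventually (gt_mem_nhds hε)] with v hv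
  have h2 := abs_real_inner_le_norm (K (v - u)) (v - u)
  have h3 : ‖K (v - u)‖ * ‖v - u‖ ≤ ε * ‖v - u‖ := by gcongr
  rw [Real.norm_eq_abs, abs_mul, abs_of_pos (by norm_num : (0 : ℝ) < 1 / 2)]
  linarith [abs_nonneg ⟪K (v - u), v - u⟫]

theorem gradient_eq [FiniteDimensional ℝ X] [CompleteSpace X] (h : IsQuadratic q K b c)
    (u : X) : gradient q u = K u + b :=
  (h.hasGradientAt u).gradient

theorem eq_zero_of_isMinOn [FiniteDimensional ℝ X] [CompleteSpace X] (h : IsQuadratic q K b c)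
    {u : X} (hu : IsMinOn q Set.univ u) : K u + b = 0 := by
  have h1 := (hu.isLocalMin univ_mem).hasFDerivAt_eq_zero (h.hasGradientAt u).hasFDerivAt
  exact (InnerProductSpace.toDual ℝ X).map_eq_zero_iff.1 h1

theorem continuous [FiniteDimensional ℝ X] (h : IsQuadratic q K b c) : Continuous q := by
  have hK := K.continuous_of_finiteDimensional
  rw [show q = fun u => 1 / 2 * ⟪K u, u⟫ + ⟪b, u⟫ + c from funext h.eq]
  fun_prop

theorem add {q' : X → ℝ} {K' : X →ₗ[ℝ] X} {b' : X} {c' : ℝ} (h : IsQuadratic q K b c)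
    (h' : IsQuadratic q' K' b' c') :
    IsQuadratic (fun u => q u + q' u) (K + K') (b + b') (c + c') where
  symm := h.symm.add h'.symm
  eq u := by
    rw [h.eq, h'.eq]
    simp only [LinearMap.add_apply, inner_add_left]
    ring

theorem sub {q' : X → ℝ} {K' : X →ₗ[ℝ] X} {b' : X} {c' : ℝ} (h : IsQuadratic q K b c)
    (h' : IsQuadratic q' K' b' c') :
    IsQuadratic (fun u => q u - q' u) (K - K') (b - b') (c - c') where
  symm := h.symm.sub h'.symm
  eq u := by
    rw [h.eq, h'.eq]
    simp only [LinearMap.sub_apply, inner_sub_left]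
    ring

end IsQuadratic

theorem LinearMap.exists_norm_le_mul {Y : Type*} [NormedAddCommGroup Y] [NormedSpace ℝ Y]
    [FiniteDimensional ℝ Y] (K : Y →ₗ[ℝ] X) :
    ∃ C, 0 ≤ C ∧ ∀ v, ‖K v‖ ≤ C * ‖v‖ :=
  ⟨_, norm_nonneg _, (LinearMap.toContinuousLinearMap K).le_opNorm⟩

/-- A symmetric operator on a finite dimensional space is bounded below on its range. -/
theorem LinearMap.IsSymmetric.exists_inner_le_mul_norm_sq [FiniteDimensional ℝ X]
    {K : X →ₗ[ℝ] X} (hK : K.IsSymmetric) : ∃ C, 0 ≤ C ∧ ∀ w, ⟪K w, w⟫ ≤ C * ‖K w‖ ^ 2 := by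
  -- A bounded right inverse of `K` onto its range replaces `w` by `w'` with the same image and norm
  -- at most `C * ‖K w‖`; symmetry makes the form depend only on that image.
  obtain ⟨g, hg⟩ := K.rangeRestrict.exists_rightInverse_of_surjective K.range_rangeRestrict
  obtain ⟨C, hC, hgC⟩ := g.exists_norm_le_mul
  refine ⟨C, hC, fun w => ?_⟩
  set w' := g (K.rangeRestrict w) with hw'
  have h1 : K w' = K w := by
    have := congrArg Subtype.val (LinearMap.congr_fun hg (K.rangeRestrict w))
    simpa using this
  have h2 : ‖w'‖ ≤ C * ‖K w‖ := hgC (K.rangeRestrict w)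
  calc ⟪K w, w⟫ = ⟪w', K w⟫ := by rw [← h1, hK w' w, h1]
    _ ≤ ‖w'‖ * ‖K w‖ := real_inner_le_norm _ _
    _ ≤ C * ‖K w‖ * ‖K w‖ := by gcongr
    _ = _ := by ring

/-- The Łojasiewicz inequality with exponent `1 / 2` for a quadratic function at its critical
points. -/
theorem IsQuadratic.exists_sub_le_mul_norm_sq [FiniteDimensional ℝ X] {q : X → ℝ}
    {K : X →ₗ[ℝ] X} {b : X} {c : ℝ} (h : IsQuadratic q K b c) :
    ∃ C, 0 ≤ C ∧ ∀ a u, K a + b = 0 → q u - q a ≤ C * ‖K u + b‖ ^ 2 := by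
  obtain ⟨C, hC, hK⟩ := h.symm.exists_inner_le_mul_norm_sq
  refine ⟨C, hC, fun a u ha => ?_⟩
  have h1 : K u + b = K (u - a) := by
    rw [map_sub, eq_neg_of_add_eq_zero_left ha]
    abel
  rw [h.expansion a u, ha, h1, inner_zero_left]
  nlinarith [hK (u - a), mul_nonneg hC (sq_nonneg ‖K (u - a)‖)]

theorem LinearMap.exists_pos_mul_norm_sq_le_inner [FiniteDimensional ℝ X] {M : X →ₗ[ℝ] X}
    (hM : ∀ v, v ≠ 0 → 0 < ⟪v, M v⟫) : ∃ m, 0 < m ∧ ∀ v, m * ‖v‖ ^ 2 ≤ ⟪v, M v⟫ := by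
  have hc : Continuous fun v => ⟪v, M v⟫ := by
    have := M.continuous_of_finiteDimensional
    fun_prop
  -- The sphere is empty only for trivial `X`; otherwise `m` is the minimum of the form on it.
  rcases (Metric.sphere (0 : X) 1).eq_empty_or_nonempty with he | hne
  · refine ⟨1, one_pos, fun v => ?_⟩
    have : v = 0 := by
      by_contra hv
      have : (‖v‖⁻¹ • v) ∈ Metric.sphere (0 : X) 1 := by
        simp [norm_smul, inv_mul_cancel₀ (norm_ne_zero_iff.2 hv)]
      simp [he] at this
    simp [this]
  · obtain ⟨w, hw, hmin⟩ := (isCompact_sphere (0 : X) 1).exists_isMinOn hne hc.continuousOn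
    have hw0 : w ≠ 0 := by
      rintro rfl
      simp at hw
    refine ⟨⟪w, M w⟫, hM w hw0, fun v => ?_⟩
    rcases eq_or_ne v 0 with rfl | hv
    · simp
    have hv' : ‖v‖ ≠ 0 := norm_ne_zero_iff.2 hv
    have h1 : (‖v‖⁻¹ • v) ∈ Metric.sphere (0 : X) 1 := by
      simp [norm_smul, inv_mul_cancel₀ hv']
    have h2 : ⟪w, M w⟫ ≤ ⟪‖v‖⁻¹ • v, M (‖v‖⁻¹ • v)⟫ := hmin h1
    rw [map_smul, inner_smul_left, inner_smul_right] at h2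
    calc ⟪w, M w⟫ * ‖v‖ ^ 2 ≤ ‖v‖⁻¹ * (‖v‖⁻¹ * ⟪v, M v⟫) * ‖v‖ ^ 2 := by
          gcongr
          simpa using h2
      _ = ⟪v, M v⟫ := by field_simp

/-- `T` is `A^* A`, with the adjoint taken onto the range of `A`, which is finite-dimensional even
if `Z` is not. -/
theorem LinearMap.exists_inner_eq_inner_map [FiniteDimensional ℝ X] {Z : Type*}
    [NormedAddCommGroup Z] [InnerProductSpace ℝ Z] (A : X →ₗ[ℝ] Z) :
    ∃ T : X →ₗ[ℝ] X, ∀ u v, ⟪T u, v⟫ = ⟪A u, A v⟫ :=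
  ⟨LinearMap.adjoint A.rangeRestrict ∘ₗ A.rangeRestrict, fun u v => by
    rw [LinearMap.comp_apply, LinearMap.adjoint_inner_left]
    rfl⟩

/-- A function which near `z` agrees with a convex quadratic function has the gradient
of the latter as a regular subgradient. -/
theorem IsQuadratic.mem_regularSubdiff {q : X → ℝ}
    {K : X →ₗ[ℝ] X} {b : X} {c : ℝ} (h : IsQuadratic q K b c) (hK : ∀ v, 0 ≤ ⟪K v, v⟫)
    {F : X → ℝ} {z : X} (hF : F =ᶠ[𝓝 z] q) : K z + b ∈ regularSubdiff F z := by
  change (0 : EReal) ≤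
    liminf (fun y => (((F y - F z - ⟪K z + b, y - z⟫) / ‖y - z‖ : ℝ) : EReal)) (𝓝[≠] z)
  refine le_liminf_of_le (by isBoundedDefault) ?_
  filter_upwards [nhdsWithin_le_nhds hF] with y hy
  rw [hy, hF.self_of_nhds, h.expansion z y]
  have h1 : q z + ⟪K z + b, y - z⟫ + 1 / 2 * ⟪K (y - z), y - z⟫ - q z - ⟪K z + b, y - z⟫
      = 1 / 2 * ⟪K (y - z), y - z⟫ := by ring
  rw [h1]
  have := hK (y - z)
  exact_mod_cast (by positivity : (0 : ℝ) ≤ 1 / 2 * ⟪K (y - z), y - z⟫ / ‖y - z‖)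

end Quadratic

/-! ### Summability from sufficient decrease. -/

/-- If `r` decreases by at least a multiple of `d ^ 2` and is bounded by a multiple of two
consecutive terms of `d ^ 2`, then `d` is summable. -/
theorem summable_of_sq_le_sub_of_le_sq {r d : ℕ → ℝ} {α C : ℝ} (hr : ∀ t, 0 ≤ r t)
    (hd : ∀ t, 0 ≤ d t) (hα : 0 < α) (hC : 0 ≤ C) (h1 : ∀ t, α * d t ^ 2 ≤ r t - r (t + 1))
    (h2 : ∀ t, r t ≤ C * (d t ^ 2 + d (t + 1) ^ 2)) : Summable d := by
  set s : ℕ → ℝ := fun t => √(r t) with hs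
  have hs0 : ∀ t, 0 ≤ s t := fun t => Real.sqrt_nonneg _
  have hsr : ∀ t, s t ^ 2 = r t := fun t => Real.sq_sqrt (hr t)
  have hmono : ∀ t, r (t + 1) ≤ r t := fun t => by
    nlinarith [h1 t, mul_nonneg hα.le (sq_nonneg (d t))]
  have hsmono : ∀ t, s (t + 1) ≤ s t := fun t => Real.sqrt_le_sqrt (hmono t)
  set B : ℝ := 2 * (√C / α) with hB
  have hB0 : 0 ≤ B := by positivity
  -- The gap is two because `h2` involves two consecutive steps. With `δ = s t - s (t + 2)`,
  -- factoring the decrease gives `α D ≤ 2 δ s t`; inserting `s t ^ 2 ≤ C D` gives `α s t ≤ 2 C δ`,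
  -- hence `α² D ≤ 4 C δ²`.
  have key : ∀ t, d t ≤ B * (s t - s (t + 2)) := by
    intro t
    have e0 : 0 ≤ s t - s (t + 2) := by linarith [hsmono t, hsmono (t + 1)]
    set D := d t ^ 2 + d (t + 1) ^ 2 with hD
    have e1 : α * D ≤ 2 * (s t - s (t + 2)) * s t := by
      have := h1 t
      have := h1 (t + 1)
      have e : α * D ≤ s t ^ 2 - s (t + 2) ^ 2 := by
        rw [hsr, hsr, hD, mul_add]
        linarith
      nlinarith
    have e2 : s t ^ 2 ≤ C * D := by rw [hsr]; exact h2 t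
    have e3 : α * s t ≤ 2 * C * (s t - s (t + 2)) := by
      rcases (hs0 t).eq_or_lt with h0 | hpos
      · rw [← h0] at e0 ⊢
        have := mul_nonneg hC e0
        linarith
      · have : (α * s t) * s t ≤ (2 * C * (s t - s (t + 2))) * s t := by
          nlinarith [mul_le_mul_of_nonneg_left e1 hC, mul_le_mul_of_nonneg_left e2 hα.le]
        exact le_of_mul_le_mul_right this hpos
    have e4 : α ^ 2 * D ≤ 4 * C * (s t - s (t + 2)) ^ 2 := by
      nlinarith [mul_le_mul_of_nonneg_left e1 hα.le, mul_le_mul_of_nonneg_left e3 e0]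
    have e5 : d t ^ 2 ≤ (B * (s t - s (t + 2))) ^ 2 := by
      have : (B * (s t - s (t + 2))) ^ 2 = 4 * C * (s t - s (t + 2)) ^ 2 / α ^ 2 := by
        rw [hB, mul_pow, mul_pow, div_pow, Real.sq_sqrt hC]
        ring
      rw [this, le_div_iff₀ (by positivity)]
      nlinarith [mul_nonneg (sq_nonneg α) (sq_nonneg (d (t + 1)))]
    exact (sq_le_sq₀ (hd t) (mul_nonneg hB0 e0)).1 e5
  refine summable_of_sum_range_le (c := B * (2 * s 0)) hd fun n => ?_
  have hsum : ∀ n, ∑ t ∈ Finset.range n, d t ≤ B * (s 0 + s 1 - s n - s (n + 1)) := by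
    intro n
    induction n with
    | zero => simp
    | succ n ih =>
      rw [Finset.sum_range_succ]
      have := key n
      have e : n + 1 + 1 = n + 2 := rfl
      rw [e]
      nlinarith
  refine (hsum n).trans (mul_le_mul_of_nonneg_left ?_ hB0)
  linarith [hsmono 0, hs0 n, hs0 (n + 1)]

/-! ### Piecewise quadratic structure of the objective. -/

namespace TQProblem

variable {X Z V Ω : Type*}
  [NormedAddCommGroup X] [InnerProductSpace ℝ X]
  [NormedAddCommGroup Z] [InnerProductSpace ℝ Z]
  [NormedAddCommGroup V] [InnerProductSpace ℝ V]

theorem exists_isQuadratic_f [FiniteDimensional ℝ X] [CompleteSpace X] (Q : TQProblem X Z V Ω) :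
    ∃ (T : X →ₗ[ℝ] X) (b : X) (c : ℝ), IsQuadratic Q.f T b c ∧ ∀ u, 0 ≤ ⟪T u, u⟫ := by
  obtain ⟨T, hT⟩ := (Q.A : X →ₗ[ℝ] Z).exists_inner_eq_inner_map
  refine ⟨T, -(InnerProductSpace.toDual ℝ X).symm ((innerSL ℝ Q.u0).comp Q.A),
    1 / 2 * ‖Q.u0‖ ^ 2, ⟨fun u v => ?_, fun u => ?_⟩, fun u => ?_⟩
  · rw [hT, real_inner_comm (T v) u, hT, real_inner_comm]
  · rw [inner_neg_left, InnerProductSpace.toDual_symm_apply, hT, f, norm_sub_sq_real]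
    simp only [ContinuousLinearMap.coe_coe, real_inner_self_eq_norm_sq,
      ContinuousLinearMap.comp_apply, innerSL_apply_apply]
    rw [real_inner_comm]
    ring
  · rw [hT]
    exact real_inner_self_nonneg

/-- The component `u ↦ ∇_l u (p)` of the discrete gradient. -/
noncomputable def comp (Q : TQProblem X Z V Ω) (l : Fin 2) (p : Ω) : X →ₗ[ℝ] V :=
  (LinearMap.proj p : (Ω → V) →ₗ[ℝ] V) ∘ₗ Q.grad l

/-- The quantity that the model compares with the threshold `λ / μ`. -/
noncomputable def truncArg (Q : TQProblem X Z V Ω) (u : X) (l : Fin 2) (p : Ω) : ℝ :=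
  match Q.kind with
  | .iso => Q.gradSq u p
  | .ani => Q.compSq l u p

open Classical in
theorem chi_eq (Q : TQProblem X Z V Ω) (u : X) (l : Fin 2) (p : Ω) :
    Q.chi u l p = if Q.lam / Q.mu ≤ Q.truncArg u l p then 1 else 0 := by
  unfold chi truncArg
  cases Q.kind <;> rfl

theorem chi_eq_zero_or_one (Q : TQProblem X Z V Ω) (u : X) (l : Fin 2) (p : Ω) :
    Q.chi u l p = 0 ∨ Q.chi u l p = 1 := by
  rw [chi_eq]
  split_ifs <;> simp

theorem finite_range_chi [Finite Ω] (Q : TQProblem X Z V Ω) : (Set.range Q.chi).Finite := by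
  have h : (Set.univ.pi fun _ : Fin 2 =>
      (Set.univ.pi fun _ : Ω => ({0, 1} : Set ℝ))).Finite :=
    Set.Finite.pi fun _ => Set.Finite.pi fun _ => Set.toFinite _
  refine h.subset ?_
  rintro _ ⟨u, rfl⟩ l _ p _
  simpa using Q.chi_eq_zero_or_one u l p

theorem truncArg_smul (Q : TQProblem X Z V Ω) (r : ℝ) (u : X) (l : Fin 2) (p : Ω) :
    Q.truncArg (r • u) l p = r ^ 2 * Q.truncArg u l p := by
  unfold truncArg gradSq compSq
  cases Q.kind <;> simp [norm_smul, mul_pow, mul_add]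

section

variable [FiniteDimensional ℝ X]

theorem continuous_compSq (Q : TQProblem X Z V Ω) (l : Fin 2) (p : Ω) :
    Continuous fun u => Q.compSq l u p :=
  ((Q.comp l p).continuous_of_finiteDimensional.norm).pow 2

theorem continuous_gradSq (Q : TQProblem X Z V Ω) (p : Ω) : Continuous fun u => Q.gradSq u p :=
  continuous_finsetSum _ fun l _ => Q.continuous_compSq l p

theorem continuous_truncArg (Q : TQProblem X Z V Ω) (l : Fin 2) (p : Ω) :
    Continuous fun u => Q.truncArg u l p := by
  unfold truncArg
  cases Q.kind
  · exact Q.continuous_gradSq p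
  · exact Q.continuous_compSq l p

theorem continuous_P2 [Fintype Ω] (Q : TQProblem X Z V Ω) : Continuous Q.P2 := by
  have h1 := Q.continuous_compSq
  have h2 := Q.continuous_gradSq
  unfold P2
  cases Q.kind
  · exact continuous_finsetSum _ fun p _ => ((h2 p).max continuous_const).const_mul _
  · exact continuous_finsetSum _ fun p _ => (continuous_finsetSum _ fun l _ =>
      (h1 l p).max continuous_const).const_mul _

/-- Near `(1 + ε) • u` with small `ε > 0`, the indicator `chi` is constant, equal to `chi u`. -/
theorem eventually_eventually_chi_eq [Finite Ω] (Q : TQProblem X Z V Ω) (u : X) :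
    ∀ᶠ ε : ℝ in 𝓝[>] 0, ∀ᶠ z in 𝓝 ((1 + ε) • u), Q.chi z = Q.chi u := by
  have hpos : 0 < Q.lam / Q.mu := div_pos Q.lam_pos Q.mu_pos
  have h : ∀ l p, ∀ᶠ ε : ℝ in 𝓝[>] 0, ∀ᶠ z in 𝓝 ((1 + ε) • u),
      Q.chi z l p = Q.chi u l p := by
    intro l p
    -- Scaling by `1 + ε` turns the weak inequality, threshold included, into a strict one because
    -- `λ / μ > 0`. A strictly smaller value stays smaller for small `ε`. Strict inequalities
    -- persist nearby.
    by_cases hu : Q.lam / Q.mu ≤ Q.truncArg u l p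
    · filter_upwards [self_mem_nhdsWithin] with ε hε
      have hε' : (0 : ℝ) < ε := hε
      have h1 : Q.lam / Q.mu < Q.truncArg ((1 + ε) • u) l p := by
        rw [truncArg_smul]
        have hψ : 0 < Q.truncArg u l p := hpos.trans_le hu
        nlinarith [mul_pos hε' hψ, mul_pos (mul_pos hε' hε') hψ]
      filter_upwards [(Q.continuous_truncArg l p).continuousAt.eventually (lt_mem_nhds h1)]
        with z hz
      rw [chi_eq, chi_eq, if_pos hu, if_pos hz.le]
    · have hu' := not_le.1 hu
      have hc : Continuous fun ε : ℝ => Q.truncArg ((1 + ε) • u) l p :=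
        (Q.continuous_truncArg l p).comp (by fun_prop)
      have h0 : Q.truncArg ((1 + (0 : ℝ)) • u) l p < Q.lam / Q.mu := by simpa using hu'
      filter_upwards [nhdsWithin_le_nhds (hc.continuousAt.eventually (gt_mem_nhds h0))] with ε h1
      filter_upwards [(Q.continuous_truncArg l p).continuousAt.eventually (gt_mem_nhds h1)]
        with z hz
      rw [chi_eq, chi_eq, if_neg hu, if_neg (not_le.2 hz)]
  have h' := eventually_all.2 fun l => eventually_all.2 (h l)
  filter_upwards [h'] with ε hε
  filter_upwards [eventually_all.2 fun l => eventually_all.2 (hε l)] with z hz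
  funext l p
  exact hz l p

end

section

variable [Fintype Ω]

theorem F_eq (Q : TQProblem X Z V Ω) (u : X) : Q.F u = Q.f u + Q.P1 u - Q.P2 u := by
  have h : ∀ a b : ℝ, min a b = a + b - max a b := fun a b => by linarith [min_add_max a b]
  unfold F P P1 P2
  cases Q.kind <;> simp only [h, Finset.sum_sub_distrib, mul_sub] <;> ring

theorem F_nonneg (Q : TQProblem X Z V Ω) (u : X) : 0 ≤ Q.F u := by
  have hm := Q.mu_pos
  have hl := Q.lam_pos
  have h1 : ∀ l p, 0 ≤ Q.compSq l u p := fun l p => sq_nonneg _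
  have h2 : ∀ p, 0 ≤ Q.gradSq u p := fun p => Finset.sum_nonneg fun l _ => h1 l p
  have h3 : 0 ≤ Q.lam / Q.mu := by positivity
  refine add_nonneg (div_nonneg (sq_nonneg _) zero_le_two) ?_
  unfold P
  cases Q.kind
  · exact Finset.sum_nonneg fun p _ => mul_nonneg (by positivity) (le_min (h2 p) h3)
  · exact Finset.sum_nonneg fun p _ => mul_nonneg (by positivity)
      (Finset.sum_nonneg fun l _ => le_min (h1 l p) h3)

variable [FiniteDimensional ℝ X] [FiniteDimensional ℝ V]

/-- The operator `μ ∑ l, ∇_l^* c_l ∇_l` with weights `c`. -/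
noncomputable def weightedOp (Q : TQProblem X Z V Ω) (c : Fin 2 → Ω → ℝ) : X →ₗ[ℝ] X :=
  Q.mu • ∑ l, ∑ p, c l p • (LinearMap.adjoint (Q.comp l p) ∘ₗ Q.comp l p)

theorem inner_weightedOp (Q : TQProblem X Z V Ω) (c : Fin 2 → Ω → ℝ) (u v : X) :
    ⟪Q.weightedOp c u, v⟫ = Q.mu * ∑ l, ∑ p, c l p * ⟪Q.comp l p u, Q.comp l p v⟫ := by
  simp only [weightedOp, LinearMap.smul_apply, LinearMap.sum_apply, LinearMap.comp_apply,
    inner_smul_left, sum_inner, LinearMap.adjoint_inner_left]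
  rfl

theorem inner_weightedOp_self (Q : TQProblem X Z V Ω) (c : Fin 2 → Ω → ℝ) (u : X) :
    ⟪Q.weightedOp c u, u⟫ = Q.mu * ∑ l, ∑ p, c l p * Q.compSq l u p := by
  rw [inner_weightedOp]
  simp only [real_inner_self_eq_norm_sq]
  rfl

theorem isSymmetric_weightedOp (Q : TQProblem X Z V Ω) (c : Fin 2 → Ω → ℝ) :
    (Q.weightedOp c).IsSymmetric := fun u v => by
  rw [real_inner_comm (Q.weightedOp c v) u, inner_weightedOp, inner_weightedOp]
  simp only [real_inner_comm]

/-- Comparing weights `chi ≤ 1` makes each branch of `F` convex; comparing `0 ≤ 1` makes `P1`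
convex. -/
theorem inner_weightedOp_self_le (Q : TQProblem X Z V Ω) {c c' : Fin 2 → Ω → ℝ}
    (h : ∀ l p, c l p ≤ c' l p) (u : X) :
    ⟪Q.weightedOp c u, u⟫ ≤ ⟪Q.weightedOp c' u, u⟫ := by
  rw [inner_weightedOp_self, inner_weightedOp_self]
  refine mul_le_mul_of_nonneg_left (Finset.sum_le_sum fun l _ => Finset.sum_le_sum fun p _ =>
    mul_le_mul_of_nonneg_right (h l p) (sq_nonneg _)) Q.mu_pos.le

theorem subgradSel_eq (Q : TQProblem X Z V Ω) (u : X) :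
    Q.subgradSel u = Q.weightedOp (Q.chi u) u := by
  simp only [subgradSel, weightedOp, LinearMap.smul_apply, LinearMap.sum_apply,
    LinearMap.comp_apply, map_smul]
  rfl

theorem exists_isQuadratic_P1 (Q : TQProblem X Z V Ω) :
    ∃ c, IsQuadratic Q.P1 (Q.weightedOp 1) 0 c := by
  have h : ∃ c, ∀ u, Q.P1 u = 1 / 2 * ⟪Q.weightedOp 1 u, u⟫ + c := by
    simp only [inner_weightedOp_self]
    unfold P1 gradSq
    cases Q.kind
    · refine ⟨∑ _p : Ω, Q.mu / 2 * (Q.lam / Q.mu), fun u => ?_⟩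
      simp only [mul_add, Finset.sum_add_distrib, Fin.sum_univ_two, Finset.mul_sum, Pi.one_apply,
        one_mul]
      simp only [← mul_assoc, one_div_mul_eq_div]
    · refine ⟨∑ _p : Ω, Q.mu / 2 * ∑ _l : Fin 2, (Q.lam / Q.mu), fun u => ?_⟩
      simp only [mul_add, Finset.sum_add_distrib, Fin.sum_univ_two, Finset.mul_sum, Pi.one_apply,
        one_mul]
      simp only [← mul_assoc, one_div_mul_eq_div]
  obtain ⟨c, hc⟩ := h
  exact ⟨c, Q.isSymmetric_weightedOp 1, fun u => by rw [hc, inner_zero_left, add_zero]⟩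

/-- On the set where `chi` takes the value `c`, the function `P2` is a quadratic function. -/
theorem exists_P2_eq (Q : TQProblem X Z V Ω) (c : Fin 2 → Ω → ℝ) :
    ∃ k, ∀ u, Q.chi u = c → Q.P2 u = 1 / 2 * ⟪Q.weightedOp c u, u⟫ + k := by
  rcases hk : Q.kind with _ | _
  · refine ⟨∑ p, Q.mu / 2 * ((1 - c 0 p) * (Q.lam / Q.mu)), fun u hu => ?_⟩
    have h : ∀ p, max (Q.gradSq u p) (Q.lam / Q.mu)
        = c 0 p * Q.compSq 0 u p + c 1 p * Q.compSq 1 u p + (1 - c 0 p) * (Q.lam / Q.mu) := by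
      intro p
      rw [← hu, chi_eq, chi_eq]
      simp only [truncArg, hk]
      split_ifs with h
      · rw [max_eq_left h, gradSq, Fin.sum_univ_two]
        ring
      · rw [max_eq_right (not_le.1 h).le]
        ring
    rw [inner_weightedOp_self]
    simp only [P2, hk, h]
    simp only [mul_add, Finset.sum_add_distrib, Fin.sum_univ_two, Finset.mul_sum]
    simp only [← mul_assoc, one_div_mul_eq_div]
  · refine ⟨∑ p, Q.mu / 2 * ∑ l, ((1 - c l p) * (Q.lam / Q.mu)), fun u hu => ?_⟩
    have h : ∀ l p, max (Q.compSq l u p) (Q.lam / Q.mu)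
        = c l p * Q.compSq l u p + (1 - c l p) * (Q.lam / Q.mu) := by
      intro l p
      rw [← hu, chi_eq]
      simp only [truncArg, hk]
      split_ifs with h
      · rw [max_eq_left h]
        ring
      · rw [max_eq_right (not_le.1 h).le]
        ring
    rw [inner_weightedOp_self]
    simp only [P2, hk, h]
    simp only [mul_add, Finset.sum_add_distrib, Fin.sum_univ_two, Finset.mul_sum]
    simp only [← mul_assoc, one_div_mul_eq_div]

/-- On the set where `chi` takes the value `c`, the objective is a quadratic function. -/
theorem exists_isQuadratic_branch (Q : TQProblem X Z V Ω) {T : X →ₗ[ℝ] X} {b : X} {k : ℝ}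
    (hf : IsQuadratic Q.f T b k) (c : Fin 2 → Ω → ℝ) :
    ∃ (q : X → ℝ) (k' : ℝ), IsQuadratic q (T + Q.weightedOp 1 - Q.weightedOp c) b k' ∧
      ∀ u, Q.chi u = c → Q.F u = q u := by
  obtain ⟨k1, h1⟩ := Q.exists_isQuadratic_P1
  obtain ⟨k2, h2⟩ := Q.exists_P2_eq c
  have h3 : IsQuadratic (fun u => 1 / 2 * ⟪Q.weightedOp c u, u⟫ + k2) (Q.weightedOp c) 0 k2 :=
    ⟨Q.isSymmetric_weightedOp c, fun u => by rw [inner_zero_left, add_zero]⟩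
  have h4 := (hf.add h1).sub h3
  rw [add_zero, sub_zero] at h4
  exact ⟨_, _, h4, fun u hu => by rw [F_eq, h2 u hu]⟩

theorem continuous_F [CompleteSpace X] (Q : TQProblem X Z V Ω) : Continuous Q.F := by
  obtain ⟨T, b, k, hf, -⟩ := Q.exists_isQuadratic_f
  obtain ⟨k1, h1⟩ := Q.exists_isQuadratic_P1
  rw [show Q.F = fun u => Q.f u + Q.P1 u - Q.P2 u from funext Q.F_eq]
  exact (hf.continuous.add h1.continuous).sub Q.continuous_P2

/-- A limit of points `x n` at which the gradient of the active branch of the objective tends to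
`0` is a stationary point. -/
theorem isLimitingStationary_of_tendsto [CompleteSpace X] (Q : TQProblem X Z V Ω)
    {T : X →ₗ[ℝ] X} {b : X} {k : ℝ} (hf : IsQuadratic Q.f T b k) (hT : ∀ u, 0 ≤ ⟪T u, u⟫)
    {x : ℕ → X} {a : X} (hx : Tendsto x atTop (𝓝 a))
    (hG : Tendsto (fun n => (T + Q.weightedOp 1 - Q.weightedOp (Q.chi (x n))) (x n) + b)
      atTop (𝓝 0)) :
    IsLimitingStationary Q.F a := by
  -- The regular subgradients are taken at `(1 + ε n) • x n`, off the threshold, with `ε n → 0`.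
  have h : ∀ n : ℕ, ∃ ε : ℝ, 0 < ε ∧ ε < 1 / ((n : ℝ) + 1) ∧
      ∀ᶠ z in 𝓝 ((1 + ε) • x n), Q.chi z = Q.chi (x n) := by
    intro n
    have h1 : ∀ᶠ ε : ℝ in 𝓝[>] 0, ε < 1 / ((n : ℝ) + 1) :=
      nhdsWithin_le_nhds (gt_mem_nhds Nat.one_div_pos_of_nat)
    have h2 : ∀ᶠ ε : ℝ in 𝓝[>] 0, 0 < ε := self_mem_nhdsWithin
    exact (h2.and (h1.and (Q.eventually_eventually_chi_eq (x n)))).exists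
  choose ε hε0 hε1 hε using h
  have hεlim : Tendsto ε atTop (𝓝 0) :=
    squeeze_zero (fun n => (hε0 n).le) (fun n => (hε1 n).le) tendsto_one_div_add_atTop_nhds_zero_nat
  have hz : Tendsto (fun n => (1 + ε n) • x n) atTop (𝓝 a) := by
    simpa using (hεlim.const_add 1).smul hx
  set K : ℕ → X →ₗ[ℝ] X := fun n => T + Q.weightedOp 1 - Q.weightedOp (Q.chi (x n)) with hK
  refine ⟨fun n => (1 + ε n) • x n, fun n => K n ((1 + ε n) • x n) + b, hz,
    (Q.continuous_F.tendsto a).comp hz, ?_, fun n => ?_⟩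
  -- Scaling changes the branch gradient only by a factor and a multiple of the fixed `b`, so no
  -- bound on `K n` is needed.
  · have h1 : ∀ n, K n ((1 + ε n) • x n) + b
        = (1 + ε n) • (K n (x n) + b) - ε n • b := by
      intro n
      rw [map_smul]
      module
    have h2 := ((hεlim.const_add 1).smul hG).sub (hεlim.smul_const b)
    rw [smul_zero, zero_smul, sub_zero] at h2
    simp only [h1]
    exact h2
  · obtain ⟨q, k', hq, hFq⟩ := Q.exists_isQuadratic_branch hf (Q.chi (x n))
    refine hq.mem_regularSubdiff (fun v => ?_) ((hε n).mono fun z hz => hFq z hz)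
    have h1 : ⟪Q.weightedOp (Q.chi (x n)) v, v⟫ ≤ ⟪Q.weightedOp 1 v, v⟫ :=
      Q.inner_weightedOp_self_le (fun l p => by
        rcases Q.chi_eq_zero_or_one (x n) l p with h | h <;> rw [h] <;> simp) v
    simp only [LinearMap.sub_apply, LinearMap.add_apply, inner_sub_left, inner_add_left]
    linarith [hT v]

end

end TQProblem

/-! ### The iterates: energy descent, gradient bounds and finite length. -/

namespace TQProblem

variable {X Z V Ω : Type*}
  [NormedAddCommGroup X] [InnerProductSpace ℝ X]
  [NormedAddCommGroup Z] [InnerProductSpace ℝ Z]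
  [NormedAddCommGroup V] [InnerProductSpace ℝ V]
  {Q : TQProblem X Z V Ω} {M T : X →ₗ[ℝ] X} {β : ℕ → ℝ} {x y ξ : ℕ → X} {b : X} {k : ℝ}

/-- The Lipschitz bound on the gradient of the data term bounds its curvature by the metric. -/
theorem inner_curvature_le_of_lipschitzWith [FiniteDimensional ℝ X] [CompleteSpace X]
    (hf : IsQuadratic Q.f T b k) {L : ℝ≥0}
    (hL : LipschitzWith L (gradient Q.f)) (hML : (M - (L : ℝ) • LinearMap.id).IsPositive)
    (u : X) : ⟪T u, u⟫ ≤ ⟪u, M u⟫ := by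
  have h1 : ‖T u‖ ≤ L * ‖u‖ := by
    have := hL.dist_le_mul u 0
    rw [dist_eq_norm, dist_zero_right, hf.gradient_eq, hf.gradient_eq, map_zero] at this
    simpa using this
  have h2 : 0 ≤ ⟪u, M u⟫ - L * ‖u‖ ^ 2 := by
    have := hML.re_inner_nonneg_right u
    simpa [inner_sub_right, inner_smul_right] using this
  calc ⟪T u, u⟫ ≤ ‖T u‖ * ‖u‖ := real_inner_le_norm _ _
    _ ≤ L * ‖u‖ * ‖u‖ := by gcongr
    _ ≤ ⟪u, M u⟫ := by linarith [sq ‖u‖]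

section

variable [Fintype Ω]

/-- The energy which decreases along the iterates. -/
noncomputable def energy (Q : TQProblem X Z V Ω) (M : X →ₗ[ℝ] X) (x : ℕ → X) (t : ℕ) : ℝ :=
  Q.F (x t) + 1 / 2 * ⟪x t - x (t - 1), M (x t - x (t - 1))⟫

/-- If the decrease of a convergent energy controls the steps, then they tend to `0`. -/
theorem tendsto_norm_sub_zero_of_energy {α E : ℝ} (hα : 0 < α)
    (h : ∀ t, α * ‖x t - x (t - 1)‖ ^ 2 ≤ Q.energy M x t - Q.energy M x (t + 1))
    (hE : Tendsto (Q.energy M x) atTop (𝓝 E)) :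
    Tendsto (fun t => x t - x (t - 1)) atTop (𝓝 0) := by
  have h1 : Tendsto (fun t => (Q.energy M x t - Q.energy M x (t + 1)) / α) atTop (𝓝 0) := by
    simpa using (hE.sub (hE.comp (tendsto_add_atTop_nat 1))).div_const α
  have h2 : Tendsto (fun t => ‖x t - x (t - 1)‖ ^ 2) atTop (𝓝 0) :=
    squeeze_zero (fun t => sq_nonneg _) (fun t => by
      rw [le_div_iff₀ hα, mul_comm]
      exact h t) h1
  rw [tendsto_zero_iff_norm_tendsto_zero]
  simpa [Real.sqrt_sq] using h2.sqrt

/-- Facts about the iterates of the algorithm that hold for every choice of the subgradients. -/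
structure IterateBounds (Q : TQProblem X Z V Ω) (M : X →ₗ[ℝ] X) (x y : ℕ → X) (E : ℝ) :
    Prop where
  decrease : ∃ α, 0 < α ∧ ∀ t, α * ‖x t - x (t - 1)‖ ^ 2
    ≤ Q.energy M x t - Q.energy M x (t + 1)
  tendsto_energy : Tendsto (Q.energy M x) atTop (𝓝 E)
  le_energy : ∀ t, E ≤ Q.energy M x t
  bounded : Bornology.IsBounded (Set.range x)
  tendsto_step : Tendsto (fun t => x t - x (t - 1)) atTop (𝓝 0)
  tendsto_F : Tendsto (fun t => Q.F (x t)) atTop (𝓝 E)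
  norm_sub_le : ∀ t, ‖x t - y t‖ ≤ ‖x t - x (t - 1)‖

namespace IterateBounds

variable {E : ℝ}

theorem tendsto_step_succ (h : Q.IterateBounds M x y E) :
    Tendsto (fun t => x (t + 1) - x t) atTop (𝓝 0) :=
  h.tendsto_step.comp (tendsto_add_atTop_nat 1)

theorem tendsto_sub_extrapolate (h : Q.IterateBounds M x y E) :
    Tendsto (fun t => x t - y t) atTop (𝓝 0) :=
  squeeze_zero_norm h.norm_sub_le (tendsto_zero_iff_norm_tendsto_zero.1 h.tendsto_step)

end IterateBounds

variable [FiniteDimensional ℝ X] [FiniteDimensional ℝ V]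

/-- Along the iterates where the branch `c` is active, the values satisfy a Łojasiewicz
inequality with respect to the limit of the energy. -/
theorem IterateBounds.exists_F_sub_le {E : ℝ} (hb : Q.IterateBounds M x y E)
    (hf : IsQuadratic Q.f T b k)
    (hG : Tendsto (fun t => (T + Q.weightedOp 1 - Q.weightedOp (Q.chi (x t))) (x t) + b) atTop
      (𝓝 0)) (c : Fin 2 → Ω → ℝ) :
    ∃ C, 0 ≤ C ∧ ∀ᶠ t in atTop, Q.chi (x t) = c →
      Q.F (x t) - E ≤ C * ‖(T + Q.weightedOp 1 - Q.weightedOp c) (x t) + b‖ ^ 2 := by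
  -- If the branch recurs, a cluster point `a` of those iterates is critical for `q` with `q a = E`,
  -- even if `chi a` differs from `c`. Otherwise the claim is eventually vacuous.
  by_cases hfreq : ∃ᶠ t in atTop, Q.chi (x t) = c
  · obtain ⟨q, k', hq, hFq⟩ := Q.exists_isQuadratic_branch hf c
    obtain ⟨C, hC, hqC⟩ := hq.exists_sub_le_mul_norm_sq
    obtain ⟨φ, hφ, hφc⟩ := extraction_of_frequently_atTop hfreq
    obtain ⟨a, -, ψ, hψ, hlim⟩ :=
      tendsto_subseq_of_bounded hb.bounded (x := x ∘ φ) fun n => ⟨φ n, rfl⟩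
    have hθ : Tendsto (φ ∘ ψ) atTop atTop := (hφ.comp hψ).tendsto_atTop
    have hcrit : (T + Q.weightedOp 1 - Q.weightedOp c) a + b = 0 := by
      have hKc := (T + Q.weightedOp 1 - Q.weightedOp c).continuous_of_finiteDimensional
      refine tendsto_nhds_unique (((hKc.tendsto a).comp hlim).add_const b) ?_
      refine (hG.comp hθ).congr fun n => ?_
      simp only [Function.comp_apply, hφc]
    have hval : q a = E := by
      refine tendsto_nhds_unique ((hq.continuous.tendsto a).comp hlim) ?_
      refine (hb.tendsto_F.comp hθ).congr fun n => ?_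
      exact hFq _ (hφc _)
    refine ⟨C, hC, Eventually.of_forall fun t ht => ?_⟩
    rw [hFq _ ht, ← hval]
    exact hqC a (x t) hcrit
  · exact ⟨0, le_rfl, (not_frequently.1 hfreq).mono fun t ht h => absurd h ht⟩

variable [CompleteSpace X]

namespace IsPreDCAe

theorem optimality (hx : Q.IsPreDCAe M β x y ξ) (hM : M.IsSymmetric) (t : ℕ) :
    M (x (t + 1) - y t) + Q.weightedOp 1 (x (t + 1)) + (gradient Q.f (y t) - ξ t) = 0 := by
  obtain ⟨c, hP⟩ := Q.exists_isQuadratic_P1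
  set g := gradient Q.f (y t) - ξ t
  have h1 : IsQuadratic (fun z => ⟪g, z⟫ + 1 / 2 * ⟪z - y t, M (z - y t)⟫) M (g - M (y t))
      (1 / 2 * ⟪y t, M (y t)⟫) := by
    refine ⟨hM, fun z => ?_⟩
    have e1 : ⟪y t, M z⟫ = ⟪M (y t), z⟫ := (hM _ _).symm
    have e2 : ⟪z, M (y t)⟫ = ⟪M (y t), z⟫ := real_inner_comm _ _
    have e3 : ⟪M z, z⟫ = ⟪z, M z⟫ := hM _ _
    simp only [map_sub, inner_sub_left, inner_sub_right, e1, e2, e3]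
    ring
  have h2 := (h1.add hP).eq_zero_of_isMinOn (hx.argmin t)
  rw [← h2, LinearMap.add_apply, map_sub]
  abel

/-- Expand `f` at `y t`: its curvature is at most `M` towards `x (t + 1)` and nonnegative towards `x
t`. Add convexity of `P1`, the subgradient inequality for `P2`, and the optimality condition tested
against `x (t + 1) - x t`. -/
theorem F_succ_le (hx : Q.IsPreDCAe M β x y ξ) (hM : M.IsSymmetric)
    (hf : IsQuadratic Q.f T b k) (hT : ∀ u, 0 ≤ ⟪T u, u⟫) (hTM : ∀ u, ⟪T u, u⟫ ≤ ⟪u, M u⟫)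
    (t : ℕ) :
    Q.F (x (t + 1)) ≤ Q.F (x t) + 1 / 2 * ⟪x t - y t, M (x t - y t)⟫
      - 1 / 2 * ⟪x (t + 1) - x t, M (x (t + 1) - x t)⟫ := by
  obtain ⟨c, hP⟩ := Q.exists_isQuadratic_P1
  have hopt := hx.optimality hM t
  rw [hf.gradient_eq] at hopt
  have h1 := hf.expansion (y t) (x (t + 1))
  have h2 := hf.expansion (y t) (x t)
  have h3 := hP.expansion (x (t + 1)) (x t)
  have h4 := hx.subgrad t (x (t + 1))
  have h5 := hTM (x (t + 1) - y t)
  have h6 := hT (x t - y t)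
  have h7 : 0 ≤ ⟪Q.weightedOp 1 (x t - x (t + 1)), x t - x (t + 1)⟫ := by
    have := Q.inner_weightedOp_self_le (c := 0) (c' := 1) (fun _ _ => zero_le_one)
      (x t - x (t + 1))
    rw [inner_weightedOp_self] at this
    simpa using this
  rw [Q.F_eq, Q.F_eq]
  set p := x (t + 1)
  set u := x t
  set w := y t
  set g := T w + b
  have h8 : ⟪M (p - w) + Q.weightedOp 1 p + (g - ξ t), p - u⟫ = 0 := by
    rw [hopt, inner_zero_left]
  have e1 : p - u = (p - w) - (u - w) := by abel
  have e2 : u - p = (u - w) - (p - w) := by abel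
  have e3 : ⟪M (p - w), u - w⟫ = ⟪u - w, M (p - w)⟫ := real_inner_comm _ _
  have e4 : ⟪p - w, M (u - w)⟫ = ⟪u - w, M (p - w)⟫ := by rw [← hM, e3]
  have e5 : ⟪M (p - w), p - w⟫ = ⟪p - w, M (p - w)⟫ := real_inner_comm _ _
  rw [e2, add_zero, inner_sub_right (Q.weightedOp 1 p)] at h3
  rw [e2] at h7
  rw [e1] at h4 h8 ⊢
  rw [inner_sub_right] at h4
  -- In terms of `r` and `s` the claim is linear in the remaining inner products and function
  -- values.
  generalize p - w = r at *
  generalize u - w = s at *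
  simp only [inner_sub_right, inner_sub_left, inner_add_left, map_sub] at h8 h3 h7 ⊢
  linarith

theorem exists_energy_decrease (hx : Q.IsPreDCAe M β x y ξ) (hM : M.IsSymmetric)
    (hMpos : ∀ v, v ≠ 0 → 0 < ⟪v, M v⟫)
    (hf : IsQuadratic Q.f T b k) (hT : ∀ u, 0 ≤ ⟪T u, u⟫) (hTM : ∀ u, ⟪T u, u⟫ ≤ ⟪u, M u⟫) :
    ∃ α, 0 < α ∧ ∀ t, α * ‖x t - x (t - 1)‖ ^ 2 ≤ Q.energy M x t - Q.energy M x (t + 1) := by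
  obtain ⟨m, hm, hMm⟩ := LinearMap.exists_pos_mul_norm_sq_le_inner hMpos
  have hbdd : BddAbove (Set.range β) := ⟨1, by rintro _ ⟨t, rfl⟩; exact (hx.beta_mem t).2.le⟩
  set B := ⨆ t, β t with hB
  have hB1 : B < 1 := hx.beta_sup
  have hβB : ∀ t, β t ≤ B := fun t => le_ciSup hbdd t
  have hB0 : 0 ≤ B := (hx.beta_mem 0).1.trans (hβB 0)
  have hB2 : 0 < 1 - B ^ 2 := by nlinarith
  -- Extrapolation costs at most `B ^ 2` times the previous `M`-step, whereas the energy holds all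
  -- of it; `m` converts to the norm.
  refine ⟨1 / 2 * (1 - B ^ 2) * m, by positivity, fun t => ?_⟩
  have h1 := hx.F_succ_le hM hf hT hTM t
  have h2 : x t - y t = -(β t • (x t - x (t - 1))) := by
    rw [hx.extrapolate t]
    abel
  set d := x t - x (t - 1) with hd
  have h3 : ⟪x t - y t, M (x t - y t)⟫ = β t ^ 2 * ⟪d, M d⟫ := by
    rw [h2, map_neg, inner_neg_neg, map_smul, inner_smul_left, inner_smul_right]
    simp only [conj_trivial]
    ring
  have h4 : β t ^ 2 ≤ B ^ 2 := pow_le_pow_left₀ (hx.beta_mem t).1 (hβB t) 2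
  have h5 : m * ‖d‖ ^ 2 ≤ ⟪d, M d⟫ := hMm d
  have h6 : 0 ≤ ⟪d, M d⟫ := le_trans (by positivity) h5
  simp only [energy, Nat.add_sub_cancel, ← hd]
  rw [h3] at h1
  nlinarith [mul_le_mul_of_nonneg_right h4 h6, mul_le_mul_of_nonneg_left h5 hB2.le]

end IsPreDCAe

theorem IsPreDCAe.exists_iterateBounds (hx : Q.IsPreDCAe M β x y ξ) (hF : LevelBounded Q.F)
    (hM : M.IsSymmetric) (hMpos : ∀ v, v ≠ 0 → 0 < ⟪v, M v⟫)
    (hf : IsQuadratic Q.f T b k) (hT : ∀ u, 0 ≤ ⟪T u, u⟫) (hTM : ∀ u, ⟪T u, u⟫ ≤ ⟪u, M u⟫) :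
    ∃ E, Q.IterateBounds M x y E := by
  obtain ⟨α, hα, hdec⟩ := hx.exists_energy_decrease hM hMpos hf hT hTM
  have hM0 : ∀ v, 0 ≤ ⟪v, M v⟫ := fun v => by
    rcases eq_or_ne v 0 with rfl | hv
    · simp
    · exact (hMpos v hv).le
  have hanti : Antitone (Q.energy M x) := antitone_nat_of_succ_le fun t => by
    have := hdec t
    have : 0 ≤ α * ‖x t - x (t - 1)‖ ^ 2 := by positivity
    linarith
  have hFE : ∀ t, Q.F (x t) ≤ Q.energy M x t := fun t => by
    have := hM0 (x t - x (t - 1))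
    unfold energy
    linarith
  have hbdd : BddBelow (Set.range (Q.energy M x)) := ⟨0, by
    rintro _ ⟨t, rfl⟩
    exact (Q.F_nonneg _).trans (hFE t)⟩
  have hlim := tendsto_atTop_ciInf hanti hbdd
  have hstep := tendsto_norm_sub_zero_of_energy hα hdec hlim
  refine ⟨_, ⟨α, hα, hdec⟩, hlim, fun t => ciInf_le hbdd t, ?_, hstep, ?_, fun t => ?_⟩
  · refine (hF (Q.energy M x 0)).subset ?_
    rintro _ ⟨t, rfl⟩
    exact (hFE t).trans (hanti t.zero_le)
  · have hc : Continuous fun v : X => 1 / 2 * ⟪v, M v⟫ := by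
      have := M.continuous_of_finiteDimensional
      fun_prop
    have h1 := hlim.sub ((hc.tendsto 0).comp hstep)
    simpa [energy, Function.comp_def] using h1
  · have h2 : x t - y t = -(β t • (x t - x (t - 1))) := by
      rw [hx.extrapolate t]
      abel
    rw [h2, norm_neg, norm_smul, Real.norm_of_nonneg (hx.beta_mem t).1]
    exact mul_le_of_le_one_left (norm_nonneg _) (hx.beta_mem t).2.le

/-- Optimality expresses `ξ t` continuously through `x (t + 1)` and `y t`, so it converges along the
subsequence, and the subgradient inequality passes to the limit. -/
theorem IsPreDCAe.exists_convexSubdiff (hx : Q.IsPreDCAe M β x y ξ) {E : ℝ}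
    (hb : Q.IterateBounds M x y E) (hM : M.IsSymmetric) (hf : IsQuadratic Q.f T b k)
    {a : X} (ha : MapClusterPt a atTop x) :
    ∃ η ∈ convexSubdiff Q.P2 a, gradient Q.f a + gradient Q.P1 a - η = 0 := by
  obtain ⟨c, hP⟩ := Q.exists_isQuadratic_P1
  obtain ⟨φ, hφ, hxφ⟩ := ha.tendsto_subseq
  refine ⟨_, ?_, sub_self _⟩
  have hTc := T.continuous_of_finiteDimensional
  have hMc := M.continuous_of_finiteDimensional
  have hHc := (Q.weightedOp 1).continuous_of_finiteDimensional
  have hy : Tendsto (fun n => y (φ n)) atTop (𝓝 a) := by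
    simpa using hxφ.sub (hb.tendsto_sub_extrapolate.comp hφ.tendsto_atTop)
  have hs : Tendsto (fun n => x (φ n + 1)) atTop (𝓝 a) := by
    simpa using hxφ.add (hb.tendsto_step_succ.comp hφ.tendsto_atTop)
  have hξ : Tendsto (fun n => ξ (φ n)) atTop (𝓝 (gradient Q.f a + gradient Q.P1 a)) := by
    have h1 : ∀ t, ξ t = M (x (t + 1) - y t) + Q.weightedOp 1 (x (t + 1)) + (T (y t) + b) := by
      intro t
      have h2 := hx.optimality hM t
      rw [hf.gradient_eq, ← add_sub_assoc] at h2
      exact (sub_eq_zero.1 h2).symm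
    have h3 := (((hMc.tendsto _).comp (hs.sub hy)).add ((hHc.tendsto _).comp hs)).add
      (((hTc.tendsto _).comp hy).add_const b)
    rw [sub_self, map_zero, zero_add] at h3
    rw [hf.gradient_eq, hP.gradient_eq, add_zero, add_comm (T a + b), funext h1]
    exact h3
  intro v
  refine le_of_tendsto' (((Q.continuous_P2.tendsto _).comp hxφ).add
    (hξ.inner (hxφ.const_sub v))) fun n => ?_
  exact hx.subgrad (φ n) v

/-- For the standard selection `ξ t` is the gradient of the active branch of `P2`. Subtracting the
optimality condition leaves only terms linear in `x t - y t` and `x (t + 1) - x t`. -/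
theorem IsPreDCAe.exists_norm_gradient_le (hx : Q.IsPreDCAe M β x y ξ) {E : ℝ}
    (hb : Q.IterateBounds M x y E) (hM : M.IsSymmetric) (hf : IsQuadratic Q.f T b k)
    (hsel : ∀ t, ξ t = Q.subgradSel (x t)) :
    ∃ C, 0 ≤ C ∧ ∀ t, ‖(T + Q.weightedOp 1 - Q.weightedOp (Q.chi (x t))) (x t) + b‖
      ≤ C * (‖x t - x (t - 1)‖ + ‖x (t + 1) - x t‖) := by
  obtain ⟨C1, hC1, h1⟩ := T.exists_norm_le_mul
  obtain ⟨C2, hC2, h2⟩ := M.exists_norm_le_mul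
  obtain ⟨C3, hC3, h3⟩ := (Q.weightedOp 1).exists_norm_le_mul
  refine ⟨C1 + C2 + C3, by positivity, fun t => ?_⟩
  have e : (T + Q.weightedOp 1 - Q.weightedOp (Q.chi (x t))) (x t) + b
      = T (x t - y t) - M ((x t - y t) + (x (t + 1) - x t))
        - Q.weightedOp 1 (x (t + 1) - x t) := by
    have h4 := hx.optimality hM t
    rw [hf.gradient_eq, hsel t, subgradSel_eq] at h4
    rw [← sub_eq_zero, ← h4]
    simp only [LinearMap.sub_apply, LinearMap.add_apply, map_sub, map_add]
    abel
  set d := ‖x t - x (t - 1)‖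
  set d' := ‖x (t + 1) - x t‖
  have hd : ‖x t - y t‖ ≤ d := hb.norm_sub_le t
  have hd0 : 0 ≤ d := norm_nonneg _
  have hd0' : 0 ≤ d' := norm_nonneg _
  have e1 : ‖T (x t - y t)‖ ≤ C1 * d := (h1 _).trans (by gcongr)
  have e2 : ‖M ((x t - y t) + (x (t + 1) - x t))‖ ≤ C2 * (d + d') :=
    (h2 _).trans (mul_le_mul_of_nonneg_left ((norm_add_le _ _).trans (by gcongr)) hC2)
  have e3 : ‖Q.weightedOp 1 (x (t + 1) - x t)‖ ≤ C3 * d' := h3 _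
  rw [e]
  refine (norm_sub_le _ _).trans ((add_le_add_left (norm_sub_le _ _) _).trans ?_)
  nlinarith [mul_nonneg hC1 hd0', mul_nonneg hC3 hd0]

theorem IsPreDCAe.tendsto_gradient (hx : Q.IsPreDCAe M β x y ξ) {E : ℝ}
    (hb : Q.IterateBounds M x y E) (hM : M.IsSymmetric) (hf : IsQuadratic Q.f T b k)
    (hsel : ∀ t, ξ t = Q.subgradSel (x t)) :
    Tendsto (fun t => (T + Q.weightedOp 1 - Q.weightedOp (Q.chi (x t))) (x t) + b) atTop
      (𝓝 0) := by
  obtain ⟨C, -, hC⟩ := hx.exists_norm_gradient_le hb hM hf hsel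
  refine squeeze_zero_norm hC ?_
  simpa using (hb.tendsto_step.norm.add hb.tendsto_step_succ.norm).const_mul C

theorem IsPreDCAe.summable_norm_sub (hx : Q.IsPreDCAe M β x y ξ) {E : ℝ}
    (hb : Q.IterateBounds M x y E) (hM : M.IsSymmetric) (hf : IsQuadratic Q.f T b k)
    (hsel : ∀ t, ξ t = Q.subgradSel (x t)) : Summable fun t => ‖x (t + 1) - x t‖ := by
  obtain ⟨C, hC, hgrad⟩ := hx.exists_norm_gradient_le hb hM hf hsel
  choose D hD hFD using hb.exists_F_sub_le hf (hx.tendsto_gradient hb hM hf hsel)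
  -- Finitely many branches allow one Łojasiewicz constant `D'` and one starting index `N`.
  obtain ⟨D', hD'⟩ := (Q.finite_range_chi.image D).bddAbove
  have hD'le : ∀ t, D (Q.chi (x t)) ≤ D' := fun t =>
    hD' (Set.mem_image_of_mem D (Set.mem_range_self _))
  have hD'0 : 0 ≤ D' := (hD _).trans (hD'le 0)
  obtain ⟨m, hm0, hm⟩ := M.exists_norm_le_mul
  obtain ⟨α, hα, hdec⟩ := hb.decrease
  have hev := (eventually_all_finite Q.finite_range_chi).2 fun c _ => hFD c
  obtain ⟨N, hN⟩ := eventually_atTop.1 hev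
  set d : ℕ → ℝ := fun t => ‖x t - x (t - 1)‖ with hd
  have hd0 : ∀ t, 0 ≤ d t := fun t => norm_nonneg _
  have hbound : ∀ t, N ≤ t →
      Q.energy M x t - E ≤ (2 * (D' * C ^ 2) + m) * (d t ^ 2 + d (t + 1) ^ 2) := by
    intro t ht
    have h1 := hN t ht _ (Set.mem_range_self (x t)) rfl
    have h2 : ‖(T + Q.weightedOp 1 - Q.weightedOp (Q.chi (x t))) (x t) + b‖ ^ 2
        ≤ C ^ 2 * (2 * (d t ^ 2 + d (t + 1) ^ 2)) := by
      calc _ ≤ (C * (d t + d (t + 1))) ^ 2 := pow_le_pow_left₀ (norm_nonneg _) (hgrad t) 2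
        _ = C ^ 2 * (d t + d (t + 1)) ^ 2 := mul_pow _ _ _
        _ ≤ _ := by
          gcongr
          nlinarith [sq_nonneg (d t - d (t + 1))]
    have h3 : Q.F (x t) - E ≤ D' * (C ^ 2 * (2 * (d t ^ 2 + d (t + 1) ^ 2))) :=
      h1.trans (mul_le_mul (hD'le t) h2 (sq_nonneg _) hD'0)
    have h4 : ⟪x t - x (t - 1), M (x t - x (t - 1))⟫ ≤ m * d t ^ 2 := by
      calc _ ≤ ‖x t - x (t - 1)‖ * ‖M (x t - x (t - 1))‖ := real_inner_le_norm _ _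
        _ ≤ d t * (m * d t) := mul_le_mul_of_nonneg_left (hm _) (hd0 t)
        _ = m * d t ^ 2 := by ring
    have h5 := mul_nonneg hm0 (sq_nonneg (d t))
    have h6 := mul_nonneg hm0 (sq_nonneg (d (t + 1)))
    unfold energy
    linarith
  have hsum : Summable fun t => d (t + N) := by
    refine summable_of_sq_le_sub_of_le_sq (r := fun t => Q.energy M x (t + N) - E)
      (fun t => sub_nonneg.2 (hb.le_energy _)) (fun t => hd0 _) hα
      (C := 2 * (D' * C ^ 2) + m) (by positivity) (fun t => ?_) (fun t => ?_)
    · have := hdec (t + N)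
      rw [Nat.add_right_comm]
      linarith
    · have := hbound (t + N) (Nat.le_add_left _ _)
      rwa [Nat.add_right_comm] at this
  exact (summable_nat_add_iff 1).2 ((summable_nat_add_iff N).1 hsum)

end

end TQProblem

/-! ### The convergence theorem. -/

theorem mainTheorem1 {X Z V Ω : Type*}
    [NormedAddCommGroup X] [InnerProductSpace ℝ X] [FiniteDimensional ℝ X] [CompleteSpace X]
    [NormedAddCommGroup Z] [InnerProductSpace ℝ Z]
    [NormedAddCommGroup V] [InnerProductSpace ℝ V] [FiniteDimensional ℝ V]
    [Fintype Ω]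
    (Q : TQProblem X Z V Ω) (hF : LevelBounded Q.F)
    (L : ℝ≥0) (hL : LipschitzWith L (gradient Q.f))
    (M : X →ₗ[ℝ] X) (hMsymm : M.IsSymmetric) (hMpos : ∀ v, v ≠ 0 → 0 < ⟪v, M v⟫)
    (hML : (M - (L : ℝ) • LinearMap.id).IsPositive)
    (β : ℕ → ℝ) (x y ξ : ℕ → X) (hx : Q.IsPreDCAe M β x y ξ) :
    (∀ a, MapClusterPt a atTop x →
      ∃ η ∈ convexSubdiff Q.P2 a, gradient Q.f a + gradient Q.P1 a - η = 0) ∧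
    ((∀ t, ξ t = Q.subgradSel (x t)) →
      (∀ a, MapClusterPt a atTop x → IsLimitingStationary Q.F a) ∧
      Summable (fun t => ‖x (t + 1) - x t‖) ∧
      ∃ a, IsLimitingStationary Q.F a ∧ Tendsto x atTop (𝓝 a)) := by
  obtain ⟨T, b, k, hf, hT⟩ := Q.exists_isQuadratic_f
  have hTM := TQProblem.inner_curvature_le_of_lipschitzWith hf hL hML
  obtain ⟨E, hb⟩ := hx.exists_iterateBounds hF hMsymm hMpos hf hT hTM
  refine ⟨fun a ha => hx.exists_convexSubdiff hb hMsymm hf ha, fun hsel => ?_⟩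
  have hG := hx.tendsto_gradient hb hMsymm hf hsel
  have hstat : ∀ a, MapClusterPt a atTop x → IsLimitingStationary Q.F a := by
    intro a ha
    obtain ⟨φ, hφ, hlim⟩ := ha.tendsto_subseq
    exact Q.isLimitingStationary_of_tendsto hf hT hlim (hG.comp hφ.tendsto_atTop)
  have hsum := hx.summable_norm_sub hb hMsymm hf hsel
  have hcauchy : CauchySeq x := cauchySeq_of_summable_dist (by
    simpa only [dist_eq_norm, norm_sub_rev] using hsum)
  obtain ⟨a, ha⟩ := cauchySeq_tendsto_of_complete hcauchy
  exact ⟨hstat, hsum, a, hstat a ha.mapClusterPt, ha⟩
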